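/- All ordinals at which stationarity is considered are limit ordinals. For a limit ordinal $\kappa$ and sets of ordinals $S,C$, define by recursion on the ordinal $\gamma$: $S$ is $0$-stationary in $\kappa$ if $S\cap\kappa$ is unbounded in $\kappa$; for $\gamma>0$, $S$ is $\gamma$-stationary in $\kappa$ if for every $\eta<\gamma$, $\kappa$ is $\eta$-reflecting and $S\cap C\cap\kappa\neq\emptyset$ for every $C$ that is $\eta$-club in $\kappa$. Here $C$ is $\gamma$-club in $\kappa$ if $C$ is $\gamma$-stationary in $\kappa$ and every $\alpha<\kappa$ such that $C$ is $\gamma$-stationary in $\alpha$ belongs to $C$; and $\kappa$ is $\gamma$-reflecting if for all $A,B\subseteq\kappa$ that are $\gamma$-stationary in $\kappa$ there is $\alpha<\kappa$ such that $A$ and $B$ are both $\gamma$-stationary in $\alpha$. For $S\subseteq\kappa$ let $d_\gamma(S)=\{\alpha<\kappa : S\cap\alpha \text{ is } \gamma\text{-stationary in }\alpha\}$; for $S\subseteq\alpha<\kappa$ given as a subset of $\alpha$, $d_\gamma(S)$ is formed in $\alpha$, that is, it consists of ordinals $<\alpha$. The $\gamma$-club filter is $\mathcal C^\gamma(\kappa)=\{X\subseteq\kappa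 : X\text{ contains a }\gamma\text{-club of }\kappa\}$; it is normal if it is a (nonempty) filter on $\kappa$ that is closed under diagonal intersections $\triangle_{\alpha<\kappa}X_\alpha=\{\xi<\kappa:\xi\in X_\alpha\text{ for all }\alpha<\xi\}$. A $\Box^\gamma$-sequence on $\kappa$ is a sequence $\langle C_\alpha:\alpha\in d_\gamma(\kappa)\rangle$ such that for every $\alpha\in d_\gamma(\kappa)$, $C_\alpha\subseteq\alpha$ is $\gamma$-club in $\alpha$, and $C_\beta=C_\alpha\cap\beta$ for every $\beta\in d_\gamma(C_\alpha)$. A thread through it is a set $C\subseteq\kappa$ that is $\gamma$-club in $\kappa$ with $C_\alpha=C\cap\alpha$ for all $\alpha\in d_\gamma(C)$. The principle $\Box^\gamma(\kappa)$ says that some $\Box^\gamma$-sequence on $\kappa$ has no thread. Theorem. Let $\gamma$ be an ordinal and let $\kappa$ be a regular cardinal that is $\gamma$-reflecting and such that $\mathcal C^\gamma(\kappa)$ is normal. Let $S=\langle C_\alpha:\alpha\in d_\gamma(\kappa)\rangle$ be a $\Box^\gamma$-sequence on $\kappa$. Then the following are equivalent: (1) $S$ has no thread; (2) for every $T\subseteq\kappa$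 that is $(\gamma+1)$-stationary in $\kappa$ there are $S_0,S_1\subseteq T$, both $(\gamma+1)$-stationary in $\kappa$, such that for every $\alpha\in d_\gamma(\kappa)$, $d_\gamma(C_\alpha)\cap S_0=\emptyset$ or $d_\gamma(C_\alpha)\cap S_1=\emptyset$. Consequently, $\Box^\gamma(\kappa)$ implies that $\kappa$ is not $(\gamma+1)$-reflecting. -/

import Mathlib

universe u

namespace GenStat

open Set Order

/-- Given a notion `P S α` ("`S` is stationary in `α`"), the set `C` is closed below `κ`
with respect to `P`. -/
def ClosedBelowFor (P : Set Ordinal.{u} → Ordinal.{u} → Prop)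
    (C : Set Ordinal.{u}) (κ : Ordinal.{u}) : Prop :=
  ∀ α < κ, P C α → α ∈ C

/-- `C` is closed below `κ` and stationary in `κ` with respect to `P`. -/
def ClubFor (P : Set Ordinal.{u} → Ordinal.{u} → Prop)
    (C : Set Ordinal.{u}) (κ : Ordinal.{u}) : Prop :=
  ClosedBelowFor P C κ ∧ P C κ

/-- Any two subsets of `κ` that are stationary in `κ` with respect to `P` reflect
simultaneously to some `α < κ`. -/
def ReflectingFor (P : Set Ordinal.{u} → Ordinal.{u} → Prop) (κ : Ordinal.{u}) : Prop :=
  ∀ A B : Set Ordinal.{u}, A ⊆ Iio κ → B ⊆ Iio κ → P A κ → P B κ → ∃ α < κ, P A α ∧ P B α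

/-- `Stationary γ S κ`: the set of ordinals `S` is `γ`-stationary in `κ`, by recursion on `γ`.
For `γ = 0` this is unboundedness in `κ`; for `γ > 0` it says that, for every `η < γ`, `κ` is
`η`-reflecting and `S` meets (below `κ`) every `η`-club of `κ`. All notions are taken at limit
ordinals `κ` only. -/
def Stationary (γ : Ordinal.{u}) : Set Ordinal.{u} → Ordinal.{u} → Prop :=
  fun S κ =>
    IsSuccLimit κ ∧
    (γ = 0 → ∀ β < κ, ∃ s ∈ S, β < s ∧ s < κ) ∧
    ∀ η, (_h : η < γ) →
      ReflectingFor (Stationary η) κ ∧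
      ∀ C : Set Ordinal.{u}, ClubFor (Stationary η) C κ → ∃ x < κ, x ∈ S ∧ x ∈ C
termination_by γ

/-- `C` is `γ`-club in `κ`: it is `γ`-stationary-closed below `κ` and `γ`-stationary in `κ`. -/
def IsClub (γ : Ordinal.{u}) (C : Set Ordinal.{u}) (κ : Ordinal.{u}) : Prop :=
  ClubFor (Stationary γ) C κ

/-- `κ` is `γ`-reflecting. -/
def Reflecting (γ κ : Ordinal.{u}) : Prop :=
  ReflectingFor (Stationary γ) κ

/-- The `0`-stationary sets are the unbounded sets (at limit ordinals). -/
theorem stationary_zero_iff (S : Set Ordinal.{u}) (κ : Ordinal.{u}) :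
    Stationary 0 S κ ↔ IsSuccLimit κ ∧ ∀ β < κ, ∃ s ∈ S, β < s ∧ s < κ := by
  rw [Stationary]
  constructor
  · rintro ⟨h₁, h₂, -⟩
    exact ⟨h₁, h₂ rfl⟩
  · rintro ⟨h₁, h₂⟩
    exact ⟨h₁, fun _ => h₂, fun η h => absurd h (not_lt.2 zero_le)⟩

/-- The recursive clause for `γ > 0`. -/
theorem stationary_iff_of_pos {γ : Ordinal.{u}} (hγ : 0 < γ) (S : Set Ordinal.{u})
    (κ : Ordinal.{u}) :
    Stationary γ S κ ↔ IsSuccLimit κ ∧ ∀ η < γ, Reflecting η κ ∧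
      ∀ C : Set Ordinal.{u}, IsClub η C κ → ∃ x < κ, x ∈ S ∧ x ∈ C := by
  rw [Stationary]
  simp [hγ.ne', Reflecting, IsClub]

/-- `derived γ κ S` is `d_γ(S)` for a subset `S` of `κ`: the set of all `α < κ` such that
`S ∩ α` is `γ`-stationary in `α`. -/
def derived (γ κ : Ordinal.{u}) (S : Set Ordinal.{u}) : Set Ordinal.{u} :=
  {α | α < κ ∧ Stationary γ (S ∩ Iio α) α}

/-- The `γ`-club filter `𝒞^γ(κ)`: all subsets of `κ` that contain a `γ`-club of `κ`. -/
def clubFilter (γ κ : Ordinal.{u}) : Set (Set Ordinal.{u}) :=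
  {X | X ⊆ Iio κ ∧ ∃ C ⊆ X, IsClub γ C κ}

/-- The diagonal intersection of the sets `X α`, `α < κ`. -/
def diagInter (κ : Ordinal.{u}) (X : Ordinal.{u} → Set Ordinal.{u}) : Set Ordinal.{u} :=
  {ξ | ξ < κ ∧ ∀ α < ξ, ξ ∈ X α}

/-- Normality of the `γ`-club filter on `κ`: `κ` belongs to it and it is closed under diagonal
intersections. It is upward closed and does not contain `∅` by its definition, and closed under
finite intersections whenever `κ` is `γ`-reflecting, so those filter laws are not repeated. -/
def ClubFilterNormal (γ κ : Ordinal.{u}) : Prop :=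
  Iio κ ∈ clubFilter γ κ ∧
  ∀ X : Ordinal.{u} → Set Ordinal.{u},
    (∀ α < κ, X α ∈ clubFilter γ κ) → diagInter κ X ∈ clubFilter γ κ

/-- `⟨C α : α ∈ d_γ(κ)⟩` is a `□^γ`-sequence on `κ`. Only the values of `C` on `d_γ(κ)` matter. -/
def IsBoxSeq (γ κ : Ordinal.{u}) (C : Ordinal.{u} → Set Ordinal.{u}) : Prop :=
  ∀ α ∈ derived γ κ (Iio κ),
    (C α ⊆ Iio α ∧ IsClub γ (C α) α) ∧
    ∀ β ∈ derived γ α (C α), C β = C α ∩ Iio β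

/-- `D` is a thread through the sequence `C` on `κ`. -/
def IsThread (γ κ : Ordinal.{u}) (C : Ordinal.{u} → Set Ordinal.{u})
    (D : Set Ordinal.{u}) : Prop :=
  D ⊆ Iio κ ∧ IsClub γ D κ ∧ ∀ α ∈ derived γ κ D, C α = D ∩ Iio α

/-- The principle `□^γ(κ)`: some `□^γ`-sequence on `κ` has no thread. -/
def BoxPrinciple (γ κ : Ordinal.{u}) : Prop :=
  ∃ C : Ordinal.{u} → Set Ordinal.{u}, IsBoxSeq γ κ C ∧ ¬ ∃ D, IsThread γ κ C D

end GenStat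

namespace GenStat

open Set Order

variable {γ η κ : Ordinal.{u}} {S T C D E X : Set Ordinal.{u}}

/-! By coherence, every `β` in `d_γ(C α)` has `C β = C α ∩ β`, so two such points above `ε` agree on
whether `ε` belongs to `C β`. If some `ε` splits `T` by this question into two `(γ+1)`-stationary
pieces, no `d_γ(C α)` meets both. If no `ε` splits `T`, each answer is constant on `T` along a
`γ`-club. By normality the diagonal intersection of these clubs is in the filter, so on a
`(γ+1)`-stationary set `C β = A ∩ β` for one `A`, which is then a thread
(`IsBoxSeq.exists_splitting`, `IsBoxSeq.isThread`). Conversely, given a thread `D`, the `γ`-club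
`d_γ(D)` meets any two `(γ+1)`-stationary sets, and a later `α` in it has `C α = D ∩ α`. The
background facts are that `γ`-clubs are closed under intersection and under `d_γ` (`IsClub.inter`,
`IsClub.derived`). -/

theorem Stationary.isSuccLimit (h : Stationary γ S κ) : IsSuccLimit κ := by
  rw [Stationary] at h
  exact h.1

theorem Stationary.reflecting (h : Stationary γ S κ) (hη : η < γ) : Reflecting η κ :=
  (((stationary_iff_of_pos (zero_le.trans_lt hη) S κ).1 h).2 η hη).1

theorem Stationary.meets (h : Stationary γ S κ) (hη : η < γ) (hE : IsClub η E κ) :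
    ∃ x < κ, x ∈ S ∧ x ∈ E :=
  (((stationary_iff_of_pos (zero_le.trans_lt hη) S κ).1 h).2 η hη).2 E hE

theorem Stationary.mono (h : Stationary γ S κ) (hST : S ∩ Iio κ ⊆ T) : Stationary γ T κ := by
  rcases eq_or_ne γ 0 with rfl | hγ
  · rw [stationary_zero_iff] at h ⊢
    refine ⟨h.1, fun β hβ => ?_⟩
    obtain ⟨s, hs, h1, h2⟩ := h.2 β hβ
    exact ⟨s, hST ⟨hs, h2⟩, h1, h2⟩
  · have hpos : 0 < γ := pos_iff_ne_zero.2 hγ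
    refine (stationary_iff_of_pos hpos T κ).2 ⟨h.isSuccLimit, fun η hη => ⟨h.reflecting hη, ?_⟩⟩
    intro E hE
    obtain ⟨x, hx, hxS, hxE⟩ := h.meets hη hE
    exact ⟨x, hx, hST ⟨hxS, hx⟩, hxE⟩

theorem stationary_inter_Iio : Stationary γ (S ∩ Iio κ) κ ↔ Stationary γ S κ :=
  ⟨fun h => h.mono fun _ hx => hx.1.1, fun h => h.mono fun _ hx => hx⟩

/-- Final segments are `0`-club. -/
theorem isClub_zero_Ioi (hκ : IsSuccLimit κ) {β : Ordinal.{u}} (hβ : β < κ) :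
    IsClub 0 (Ioi β) κ := by
  refine ⟨fun α _ h => ?_, (stationary_zero_iff _ _).2 ⟨hκ, fun δ hδ => ?_⟩⟩
  · obtain ⟨hα, h⟩ := (stationary_zero_iff _ _).1 h
    obtain ⟨s, hs, -, h2⟩ := h 0 hα.bot_lt
    exact lt_trans hs h2
  · exact ⟨succ (max β δ), mem_Ioi.2 (lt_succ_of_le (le_max_left _ _)),
      lt_succ_of_le (le_max_right _ _),
      hκ.succ_lt (max_lt hβ hδ)⟩

theorem Stationary.of_le (h : Stationary γ S κ) (hη : η ≤ γ) : Stationary η S κ := by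
  rcases hη.eq_or_lt with rfl | hlt
  · exact h
  rcases eq_or_ne η 0 with rfl | hη0
  · refine (stationary_zero_iff _ _).2 ⟨h.isSuccLimit, fun β hβ => ?_⟩
    obtain ⟨x, hx, hxS, hxβ⟩ := h.meets hlt (isClub_zero_Ioi h.isSuccLimit hβ)
    exact ⟨x, hxS, hxβ, hx⟩
  · exact (stationary_iff_of_pos (pos_iff_ne_zero.2 hη0) _ _).2 ⟨h.isSuccLimit, fun ξ hξ =>
      ⟨h.reflecting (hξ.trans hlt), fun _ hE => h.meets (hξ.trans hlt) hE⟩⟩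

theorem Stationary.exists_gt (h : Stationary γ S κ) {β : Ordinal.{u}} (hβ : β < κ) :
    ∃ s ∈ S, β < s ∧ s < κ :=
  ((stationary_zero_iff _ _).1 (h.of_le zero_le)).2 β hβ

theorem Reflecting.exists_lt (h : Reflecting γ κ) (hS : Stationary γ S κ)
    (hT : Stationary γ T κ) : ∃ α < κ, Stationary γ S α ∧ Stationary γ T α := by
  obtain ⟨α, hα, h1, h2⟩ := h (S ∩ Iio κ) (T ∩ Iio κ) inter_subset_right inter_subset_right
    (stationary_inter_Iio.2 hS) (stationary_inter_Iio.2 hT)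
  exact ⟨α, hα, h1.mono fun _ hx => hx.1.1, h2.mono fun _ hx => hx.1.1⟩

/-! ### Intersections of clubs and the derived set of a club -/

/-- To check stationarity in `κ` it is enough to meet every set that is closed below `κ` and
whose intersections with stationary sets are stationary, as soon as the sets `E` that are
`η`-club for some `η < γ` have the latter property. -/
theorem stationary_of_forall_meets
    (hinter : ∀ Y E : Set Ordinal.{u}, ∀ η < γ, Stationary γ Y κ → IsClub η E κ →
      Stationary γ (Y ∩ E) κ)
    (hX : Stationary γ X κ)
    (h : ∀ E : Set Ordinal.{u}, (∀ α < κ, Stationary γ E α → α ∈ E) →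
      (∀ Y, Stationary γ Y κ → Stationary γ (Y ∩ E) κ) → ∃ x < κ, x ∈ S ∧ x ∈ E) :
    Stationary γ S κ := by
  rcases eq_or_ne γ 0 with rfl | hγ
  · refine (stationary_zero_iff _ _).2 ⟨hX.isSuccLimit, fun β hβ => ?_⟩
    obtain ⟨x, hx, hxS, hxβ⟩ := h (Ioi β) (isClub_zero_Ioi hX.isSuccLimit hβ).1 fun Y hY => by
      refine (stationary_zero_iff _ _).2 ⟨hX.isSuccLimit, fun δ hδ => ?_⟩
      obtain ⟨s, hs, h1, h2⟩ := hY.exists_gt (max_lt hβ hδ)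
      exact ⟨s, ⟨hs, (le_max_left _ _).trans_lt h1⟩, (le_max_right _ _).trans_lt h1, h2⟩
    exact ⟨x, hxS, hxβ, hx⟩
  · refine (stationary_iff_of_pos (pos_iff_ne_zero.2 hγ) _ _).2
      ⟨hX.isSuccLimit, fun η hη => ⟨hX.reflecting hη, fun E hE => ?_⟩⟩
    exact h E (fun α hα hEα => hE.1 α hα (hEα.of_le hη.le)) fun Y hY => hinter Y E η hη hY hE

/-- Reflecting `C ∩ E` and `D` to a common `α` puts `α` in `C`, `D` and `E` by closure. The property
`hinter` is kept as a hypothesis because this lemma serves in the induction that proves it,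
`Stationary.inter_isClub`. -/
theorem IsClub.inter_of_stationary_inter
    (hinter : ∀ Y E : Set Ordinal.{u}, ∀ η < γ, Stationary γ Y κ → IsClub η E κ →
      Stationary γ (Y ∩ E) κ)
    (hκ : Reflecting γ κ) (hC : IsClub γ C κ) (hD : IsClub γ D κ) : IsClub γ (C ∩ D) κ := by
  refine ⟨fun α hα h => ⟨hC.1 α hα (h.mono fun _ hx => hx.1.1),
    hD.1 α hα (h.mono fun _ hx => hx.1.2)⟩, ?_⟩
  refine stationary_of_forall_meets hinter hC.2 fun E hE hYE => ?_
  obtain ⟨α, hα, h1, h2⟩ := hκ.exists_lt (hYE C hC.2) hD.2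
  exact ⟨α, hα, ⟨hC.1 α hα (h1.mono fun _ hx => hx.1.1), hD.1 α hα h2⟩,
    hE α hα (h1.mono fun _ hx => hx.1.2)⟩

theorem IsClub.of_stationary_inter
    (hinter : ∀ Y E : Set Ordinal.{u}, ∀ η < γ, Stationary γ Y κ → IsClub η E κ →
      Stationary γ (Y ∩ E) κ)
    (hX : Stationary γ X κ) (hη : η ≤ γ) (hE : IsClub η E κ) : IsClub γ E κ := by
  rcases hη.eq_or_lt with rfl | hlt
  · exact hE
  · exact ⟨fun α hα h => hE.1 α hα (h.of_le hη),
      (hinter X E η hlt hX hE).mono fun _ hx => hx.1.2⟩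

/-- A `γ`-stationary set stays `γ`-stationary when intersected with an `η`-club, `η < γ`. -/
theorem Stationary.inter_isClub (hS : Stationary γ S κ) (hη : η < γ) (hE : IsClub η E κ) :
    Stationary γ (S ∩ E) κ := by
  induction γ using WellFoundedLT.induction generalizing S E η with
  | ind γ ih =>
    refine (stationary_iff_of_pos (zero_le.trans_lt hη) _ _).2
      ⟨hS.isSuccLimit, fun ξ hξ => ⟨hS.reflecting hξ, fun F hF => ?_⟩⟩
    -- Both clubs become `max η ξ`-clubs, and `κ` is `max η ξ`-reflecting, so `S` meets their
    -- intersection.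
    have hm : max η ξ < γ := max_lt hη hξ
    have hinter := fun (Y E : Set Ordinal.{u}) (ζ : Ordinal.{u}) (hζ : ζ < max η ξ)
      (hY : Stationary (max η ξ) Y κ) (hE : IsClub ζ E κ) => ih _ hm hY hζ hE
    have hSm := hS.of_le hm.le
    obtain ⟨x, hx, hxS, hxE, hxF⟩ := hS.meets hm (IsClub.inter_of_stationary_inter hinter
      (hS.reflecting hm) (IsClub.of_stationary_inter hinter hSm (le_max_left _ _) hE)
      (IsClub.of_stationary_inter hinter hSm (le_max_right _ _) hF))
    exact ⟨x, hx, ⟨hxS, hxE⟩, hxF⟩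

theorem IsClub.inter (hκ : Reflecting γ κ) (hC : IsClub γ C κ) (hD : IsClub γ D κ) :
    IsClub γ (C ∩ D) κ :=
  IsClub.inter_of_stationary_inter (fun _ _ _ hη hY hE => hY.inter_isClub hη hE) hκ hC hD

/-- An `η`-club in an ordinal that is `γ`-stationary in itself is `γ`-club, for `η ≤ γ`. -/
theorem IsClub.of_le (hE : IsClub η E κ) (hη : η ≤ γ) (hX : Stationary γ X κ) :
    IsClub γ E κ :=
  IsClub.of_stationary_inter (fun _ _ _ hη hY hE => hY.inter_isClub hη hE) hX hη hE

theorem mem_derived {α : Ordinal.{u}} : α ∈ derived γ κ S ↔ α < κ ∧ Stationary γ S α := by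
  rw [← stationary_inter_Iio (S := S)]
  rfl

theorem derived_mono (h : S ⊆ T) : derived γ κ S ⊆ derived γ κ T := fun _ hα =>
  mem_derived.2 ⟨hα.1, (mem_derived.1 hα).2.mono fun _ hx => h hx.1⟩

/-- Closure of `D` gives `d_γ(D) ⊆ D`, hence closure of `d_γ(D)`. A point to which `D ∩ E` reflects
lies in both `d_γ(D)` and `E`. -/
theorem IsClub.derived (hκ : Reflecting γ κ) (hD : IsClub γ D κ) :
    IsClub γ (derived γ κ D) κ := by
  refine ⟨fun α hα h => mem_derived.2 ⟨hα, h.mono fun x hx => ?_⟩, ?_⟩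
  · exact hD.1 x hx.1.1 (mem_derived.1 hx.1).2
  refine stationary_of_forall_meets (fun _ _ _ hη hY hE => hY.inter_isClub hη hE) hD.2
    fun E hE hYE => ?_
  obtain ⟨α, hα, h1, -⟩ := hκ.exists_lt (hYE D hD.2) hD.2
  exact ⟨α, hα, mem_derived.2 ⟨hα, h1.mono fun _ hx => hx.1.1⟩,
    hE α hα (h1.mono fun _ hx => hx.1.2)⟩

/-- At a `γ`-reflecting ordinal which is `γ`-stationary in itself, `(γ+1)`-stationarity means
meeting all `γ`-clubs. -/
theorem stationary_add_one_iff (hκ : Reflecting γ κ) (hX : Stationary γ X κ) :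
    Stationary (γ + 1) S κ ↔ ∀ E, IsClub γ E κ → ∃ x < κ, x ∈ S ∧ x ∈ E := by
  refine ⟨fun h E hE => h.meets (Order.lt_add_one_iff.2 le_rfl) hE, fun h => ?_⟩
  refine (stationary_iff_of_pos (zero_le.trans_lt (Order.lt_add_one_iff.2 le_rfl)) _ _).2
    ⟨hX.isSuccLimit, fun η hη => ?_⟩
  rw [Order.lt_add_one_iff] at hη
  refine ⟨?_, fun E hE => h E (hE.of_le hη hX)⟩
  rcases hη.eq_or_lt with rfl | hlt
  · exact hκ
  · exact hX.reflecting hlt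

theorem Stationary.inter_isClub_add_one (hS : Stationary (γ + 1) S κ) (hE : IsClub γ E κ) :
    Stationary (γ + 1) (S ∩ E) κ :=
  hS.inter_isClub (Order.lt_add_one_iff.2 le_rfl) hE

theorem stationary_add_one_Iio (hκ : Reflecting γ κ) (hX : Stationary γ X κ) :
    Stationary (γ + 1) (Iio κ) κ := by
  refine (stationary_add_one_iff hκ hX).2 fun E hE => ?_
  obtain ⟨x, hx, -, hxκ⟩ := hE.2.exists_gt hX.isSuccLimit.bot_lt
  exact ⟨x, hxκ, hxκ, hx⟩

theorem ClubFilterNormal.stationary_Iio (h : ClubFilterNormal γ κ) :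
    Stationary γ (Iio κ) κ := by
  obtain ⟨-, C, -, hC⟩ := h.1
  exact hC.2.mono inter_subset_right

theorem isClub_Iio (h : Stationary γ (Iio κ) κ) : IsClub γ (Iio κ) κ :=
  ⟨fun _ hα _ => hα, h⟩

/-- A set that is `γ`-stationary in all members of a `(γ+1)`-stationary subset of `κ` is
`γ`-stationary in `κ`. -/
theorem Stationary.of_forall_mem (hT : Stationary (γ + 1) T κ)
    (h : ∀ β ∈ T, β < κ → Stationary γ S β) : Stationary γ S κ := by
  rcases eq_or_ne γ 0 with rfl | hγ
  · refine (stationary_zero_iff _ _).2 ⟨hT.isSuccLimit, fun δ hδ => ?_⟩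
    obtain ⟨β, hβT, hδβ, hβ⟩ := hT.exists_gt hδ
    obtain ⟨s, hs, h1, h2⟩ := (h β hβT hβ).exists_gt hδβ
    exact ⟨s, hs, h1, h2.trans hβ⟩
  · refine (stationary_iff_of_pos (pos_iff_ne_zero.2 hγ) _ _).2
      ⟨hT.isSuccLimit, fun η hη => ?_⟩
    have hη' : η < γ + 1 := Order.lt_add_one_iff.2 hη.le
    refine ⟨hT.reflecting hη', fun E hE => ?_⟩
    -- At `β ∈ d_η(E)` the set `E` is `η`-club in `β`, so `S`, being `γ`-stationary there, meets it.
    obtain ⟨β, hβ, hβT, hβE⟩ := hT.meets hη' (hE.derived (hT.reflecting hη'))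
    obtain ⟨x, hx, hxS, hxE⟩ := (h β hβT hβ).meets hη
      ⟨fun α hα => hE.1 α (hα.trans hβ), (mem_derived.1 hβE).2⟩
    exact ⟨x, hx.trans hβ, hxS, hxE⟩

/-! ### Threads and splittings -/

/-- A set that coincides with `C β` below `β`, for all `β` in a `(γ+1)`-stationary set, is a
thread. -/
theorem IsBoxSeq.isThread {C : Ordinal.{u} → Set Ordinal.{u}} {A : Set Ordinal.{u}}
    (hC : IsBoxSeq γ κ C) (hT : Stationary (γ + 1) T κ)
    (hTd : T ⊆ GenStat.derived γ κ (Iio κ)) (hA : A ⊆ Iio κ)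
    (h : ∀ β ∈ T, C β = A ∩ Iio β) : IsThread γ κ C A := by
  refine ⟨hA, ⟨fun α hα hAα => ?_, ?_⟩, fun α hα => ?_⟩
  · obtain ⟨β, hβ, hαβ, -⟩ := hT.exists_gt hα
    have hmem : α ∈ C β := (hC β (hTd hβ)).1.2.1 α hαβ <| hAα.mono fun x hx => by
      rw [h β hβ]
      exact ⟨hx.1, hx.2.trans hαβ⟩
    rw [h β hβ] at hmem
    exact hmem.1
  · refine hT.of_forall_mem fun β hβ _ => ?_
    exact (hC β (hTd hβ)).1.2.2.mono fun x hx => ((h β hβ).subset hx.1).1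
  · obtain ⟨hακ, hAα⟩ := mem_derived.1 hα
    obtain ⟨β, hβ, hαβ, -⟩ := hT.exists_gt hακ
    rw [(hC β (hTd hβ)).2 α (mem_derived.2 ⟨hαβ, hAα.mono fun x hx => by
      rw [h β hβ]
      exact ⟨hx.1, hx.2.trans hαβ⟩⟩), h β hβ, inter_assoc, Iio_inter_Iio, min_eq_right hαβ.le]

/-- If a `□^γ`-sequence has no thread, then some ordinal `α` splits `T` into two
`(γ+1)`-stationary pieces according to whether `α ∈ C β`. -/
theorem IsBoxSeq.exists_splitting {C : Ordinal.{u} → Set Ordinal.{u}} (hC : IsBoxSeq γ κ C)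
    (hκ : Reflecting γ κ) (hnormal : ClubFilterNormal γ κ) (hno : ¬ ∃ D, IsThread γ κ C D)
    (hT : Stationary (γ + 1) T κ) (hTd : T ⊆ GenStat.derived γ κ (Iio κ)) :
    ∃ α, Stationary (γ + 1) {β ∈ T | α < β ∧ α ∉ C β} κ ∧
      Stationary (γ + 1) {β ∈ T | α < β ∧ α ∈ C β} κ := by
  by_contra! hcon
  have hκκ := hnormal.stationary_Iio
  -- The candidate thread: those `α` that lie in `C β` for almost all `β ∈ T`, modulo the `γ`-club
  -- filter.
  let A : Set Ordinal.{u} :=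
    {α | α < κ ∧ ¬ Stationary (γ + 1) {β ∈ T | α < β ∧ α ∉ C β} κ}
  have hclub : ∀ α < κ, ∃ E, IsClub γ E κ ∧ ∀ β ∈ E, β ∈ T → α < β → (α ∈ C β ↔ α ∈ A) := by
    intro α hα
    by_cases hαA : α ∈ A
    · have hns := hαA.2
      rw [stationary_add_one_iff hκ hκκ] at hns
      push Not at hns
      obtain ⟨E, hE, hdisj⟩ := hns
      refine ⟨E, hE, fun β hβ hβT hαβ => iff_of_true ?_ hαA⟩
      by_contra hαC
      exact hdisj β (hTd hβT).1 ⟨hβT, hαβ, hαC⟩ hβ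
    · have hns := hcon α (by_contra fun hs => hαA ⟨hα, hs⟩)
      rw [stationary_add_one_iff hκ hκκ] at hns
      push Not at hns
      obtain ⟨E, hE, hdisj⟩ := hns
      exact ⟨E, hE, fun β hβ hβT hαβ => iff_of_false
        (fun hαC => hdisj β (hTd hβT).1 ⟨hβT, hαβ, hαC⟩ hβ) hαA⟩
  choose! E hE hEA using hclub
  obtain ⟨-, F, hF, hFclub⟩ := hnormal.2 (fun α => E α ∩ Iio κ) fun α hα =>
    ⟨inter_subset_right, _, subset_rfl, (hE α hα).inter hκ (isClub_Iio hκκ)⟩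
  refine hno ⟨A, hC.isThread (hT.inter_isClub_add_one hFclub)
    (inter_subset_left.trans hTd) (fun _ hα => hα.1) fun β hβ => ?_⟩
  have hβd := hTd hβ.1
  ext α
  constructor
  · intro hα
    have hαβ : α < β := (hC β hβd).1.1 hα
    exact ⟨(hEA α (hαβ.trans hβd.1) β ((hF hβ.2).2 α hαβ).1 hβ.1 hαβ).1 hα, hαβ⟩
  · rintro ⟨hαA, hαβ⟩
    exact (hEA α hαA.1 β ((hF hβ.2).2 α hαβ).1 hβ.1 hαβ).2 hαA

theorem IsBoxSeq.exists_disjoint_of_no_thread {C : Ordinal.{u} → Set Ordinal.{u}}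
    (hC : IsBoxSeq γ κ C) (hκ : Reflecting γ κ) (hnormal : ClubFilterNormal γ κ)
    (hno : ¬ ∃ D, IsThread γ κ C D) (hT : Stationary (γ + 1) T κ) :
    ∃ S₀ ⊆ T, ∃ S₁ ⊆ T, Stationary (γ + 1) S₀ κ ∧ Stationary (γ + 1) S₁ κ ∧
      ∀ α ∈ derived γ κ (Iio κ), derived γ α (C α) ∩ S₀ = ∅ ∨ derived γ α (C α) ∩ S₁ = ∅ := by
  obtain ⟨ε, h₀, h₁⟩ := hC.exists_splitting hκ hnormal hno
    (hT.inter_isClub_add_one ((isClub_Iio hnormal.stationary_Iio).derived hκ)) inter_subset_right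
  refine ⟨_, fun β hβ => hβ.1.1, _, fun β hβ => hβ.1.1, h₀, h₁, fun α hα => ?_⟩
  by_contra! hne
  obtain ⟨⟨β₀, hβ₀, -, hlt₀, hmem₀⟩, β₁, hβ₁, -, -, hmem₁⟩ := hne
  rw [(hC α hα).2 β₀ hβ₀] at hmem₀
  rw [(hC α hα).2 β₁ hβ₁] at hmem₁
  -- `ε ∈ C β₁` gives `ε ∈ C α`; the clause `ε < β₀` then forces `ε ∈ C β₀`.
  exact hmem₀ ⟨hmem₁.1, hlt₀⟩

/-- Below a thread, any two `(γ+1)`-stationary sets meet a common `d_γ(C α)`. -/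
theorem IsThread.exists_derived_inter_nonempty {C : Ordinal.{u} → Set Ordinal.{u}}
    (hD : IsThread γ κ C D) (hκ : Reflecting γ κ)
    (hS : Stationary (γ + 1) S κ) (hT : Stationary (γ + 1) T κ) :
    ∃ α ∈ derived γ κ (Iio κ), (derived γ α (C α) ∩ S).Nonempty ∧
      (derived γ α (C α) ∩ T).Nonempty := by
  obtain ⟨hDκ, hDclub, hthread⟩ := hD
  have hd := hDclub.derived hκ
  have hlt : γ < γ + 1 := Order.lt_add_one_iff.2 le_rfl
  obtain ⟨β₀, hβ₀, hβ₀S, hβ₀D⟩ := hS.meets hlt hd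
  obtain ⟨β₁, hβ₁, hβ₁T, hβ₁D⟩ := hT.meets hlt hd
  obtain ⟨α, hα, hβα, -⟩ := hd.2.exists_gt (max_lt hβ₀ hβ₁)
  have hmem : ∀ β < α, β ∈ derived γ κ D → β ∈ derived γ α (C α) := fun β hβ hβD => by
    rw [hthread α hα]
    exact mem_derived.2 ⟨hβ, (mem_derived.1 hβD).2.mono fun x hx => ⟨hx.1, hx.2.trans hβ⟩⟩
  exact ⟨α, derived_mono hDκ hα,
    ⟨β₀, hmem β₀ ((le_max_left _ _).trans_lt hβα) hβ₀D, hβ₀S⟩,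
    ⟨β₁, hmem β₁ ((le_max_right _ _).trans_lt hβα) hβ₁D, hβ₁T⟩⟩

/-- If the two pieces obtained from `T = κ` reflected to a common `α`, then `α` would be
`γ`-reflecting, so `d_γ(C α)` would be `γ`-club in `α` and meet both. -/
theorem BoxPrinciple.not_reflecting (h : BoxPrinciple γ κ) (hκ : Reflecting γ κ)
    (hnormal : ClubFilterNormal γ κ) : ¬ Reflecting (γ + 1) κ := by
  obtain ⟨C, hC, hno⟩ := h
  obtain ⟨S₀, -, S₁, -, h₀, h₁, hdisj⟩ := hC.exists_disjoint_of_no_thread hκ hnormal hno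
    (stationary_add_one_Iio hκ hnormal.stationary_Iio)
  intro hrefl
  obtain ⟨α, hα, hα₀, hα₁⟩ := hrefl.exists_lt h₀ h₁
  have hlt : γ < γ + 1 := Order.lt_add_one_iff.2 le_rfl
  have hαd : α ∈ derived γ κ (Iio κ) :=
    mem_derived.2 ⟨hα, (hα₀.of_le hlt.le).mono fun x hx => hx.2.trans hα⟩
  have hd := (hC α hαd).1.2.derived (hα₀.reflecting hlt)
  obtain ⟨β₀, -, hβ₀S, hβ₀d⟩ := hα₀.meets hlt hd
  obtain ⟨β₁, -, hβ₁S, hβ₁d⟩ := hα₁.meets hlt hd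
  rcases hdisj α hαd with h | h
  · exact (h.subset ⟨hβ₀d, hβ₀S⟩ : β₀ ∈ (∅ : Set Ordinal.{u}))
  · exact (h.subset ⟨hβ₁d, hβ₁S⟩ : β₁ ∈ (∅ : Set Ordinal.{u}))

end GenStat

theorem mainTheorem7 (κ : Cardinal.{u}) (γ : Ordinal.{u}) (hκ : κ.IsRegular)
    (hrefl : GenStat.Reflecting γ κ.ord) (hnormal : GenStat.ClubFilterNormal γ κ.ord) :
    (∀ C : Ordinal.{u} → Set Ordinal.{u}, GenStat.IsBoxSeq γ κ.ord C →
      ((¬ ∃ D, GenStat.IsThread γ κ.ord C D) ↔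
        ∀ T ⊆ Set.Iio κ.ord, GenStat.Stationary (γ + 1) T κ.ord →
          ∃ S₀ ⊆ T, ∃ S₁ ⊆ T,
            GenStat.Stationary (γ + 1) S₀ κ.ord ∧ GenStat.Stationary (γ + 1) S₁ κ.ord ∧
            ∀ α ∈ GenStat.derived γ κ.ord (Set.Iio κ.ord),
              GenStat.derived γ α (C α) ∩ S₀ = ∅ ∨ GenStat.derived γ α (C α) ∩ S₁ = ∅)) ∧
    (GenStat.BoxPrinciple γ κ.ord → ¬ GenStat.Reflecting (γ + 1) κ.ord) := by
  refine ⟨fun C hC => ⟨fun hno T _ hT =>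
    hC.exists_disjoint_of_no_thread hrefl hnormal hno hT, ?_⟩,
    fun h => h.not_reflecting hrefl hnormal⟩
  rintro h ⟨D, hD⟩
  obtain ⟨S₀, -, S₁, -, h₀, h₁, hdisj⟩ := h _ subset_rfl
    (GenStat.stationary_add_one_Iio hrefl hnormal.stationary_Iio)
  obtain ⟨α, hα, hne₀, hne₁⟩ := hD.exists_derived_inter_nonempty hrefl h₀ h₁
  exact (hdisj α hα).elim hne₀.ne_empty hne₁.ne_empty
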